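/- **Setting.** A \emph{sample} from a set $\mathbb X$ is a finite nonempty multiset $X=\{x_i\}_{i\in I}$ of elements of $\mathbb X$, with $|X|=|I|$. A statistic $T$ on samples with values in some $\mathbb R^d$ is \emph{SEP} (strongly embarrassingly parallel) if for every partition $[I]=\{I_1,\dots,I_R\}$ of a finite nonempty index set $I$ into nonempty blocks there is a function $F_{[I]}$, symmetric in its $R$ arguments, such that $T(\{x_i\}_{i\in I})=F_{[I]}\big(T(\{x_i\}_{i\in I_1}),\dots,T(\{x_i\}_{i\in I_R})\big)$ for all data $(x_i)_{i\in I}$. A statistic is \emph{WEP} (weakly embarrassingly parallel) if it is a function of finitely many SEP statistics. A function $\Gamma(x,\theta)$ is \emph{FAS} (finitely additively separable) if $\Gamma(x,\theta)=\sum_{k=1}^K\eta_k f_k(x)g_k(\theta)$ for finitely many functions $f_k,g_k$ and constants $\eta_k$ (all complex valued). For $p\in(0,1)$ and a sample $X$ of points of $(0,1)$, a $p$th \emph{sample quantile} of $X$ is any $\theta\in(0,1)$ with $\hat F(X,\theta^-)\le p\le \hat F(X,\theta)$, where $\hat F(X,\theta)=|X|^{-1}\#\{i:x_i\le\theta\}$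 and $\hat F(X,\theta^-)=|X|^{-1}\#\{i:x_i<\theta\}$. For $J\in\mathbb N$ let $$|z|_J=\frac{\pi}{2}-\frac4\pi\sum_{j=1}^J\frac{\cos((2j-1)z)}{(2j-1)^2}.$$ **Theorem.** Let $P$ be a probability measure on $(0,1)$ that is absolutely continuous with respect to Lebesgue measure, with density $f$ positive almost everywhere on $(0,1)$. Let $x_0,x_1,\dots$ be i.i.d. random variables with law $P$, let $X_n=\{x_0,\dots,x_n\}$ (so $|X_n|=n+1$), and fix $p\in(0,1)$. 1. There is $q\in(0,1)$ with $P((0,q])=p$ such that almost surely the following hold. For every $n$ the set of $p$th sample quantiles of $X_n$ is nonempty and equals $$\operatorname*{argmin}_{\theta\in[0,1]}\sum_{i\le n}\Big[\tfrac12|x_i-\theta|+\big(p-\tfrac12\big)(x_i-\theta)\Big],$$ and it consists of exactly one point whenever $p\,|X_n|$ is not an integer. As $n\to\infty$ the $p$th sample quantile is asymptotically unique: the diameter of the set of $p$th sample quantiles of $X_n$ tends to $0$, and every choice $\hat q_p(X_n)$ of $p$th sample quantiles satisfies $\hat q_p(X_n)\to q$. 2. For every $J\in\mathbb N$, $|x-\theta|_J$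 is an FAS function, and for every sample $X$ of points of $(0,1)$ the set $$\hat Q_{J,p}(X)=\operatorname*{argmin}_{\theta\in[0,1]}\sum_{i\in I}\Big[\tfrac12|x_i-\theta|_J+\big(p-\tfrac12\big)(x_i-\theta)\Big]$$ is nonempty. The statistic $\hat Q_{J,p}$ is WEP, and so is the point $\hat q_{J,p}(X)\in\hat Q_{J,p}(X)$ obtained from it by any tie-breaking rule, that is, by any function that picks an element of each nonempty subset of $\mathbb R$. More explicitly, $\hat Q_{J,p}(X)$ is a function of the $2J+1$ SEP statistics $|X|$, $\sum_i\cos((2j-1)x_i)$ and $\sum_i\sin((2j-1)x_i)$, $1\le j\le J$. 3. Let $$\zeta_J(\theta)=\mathbb E_P\Big[\frac2\pi\sum_{j=1}^J\cos\big((2j-1)(x-\theta)\big)\Big]=\mathbb E_P\Big[\frac1\pi\cdot\frac{\sin(2J(x-\theta))}{\sin(x-\theta)}\Big].$$ If $\zeta_J$ converges uniformly on $(0,1)$ to (a version of) the density $f$, then almost surely, for every choice of minimizers $\hat q_{J,p}(X_n)\in\hat Q_{J,p}(X_n)$, $$\lim_{J\to\infty}\limsup_{n\to\infty}\hat q_{J,p}(X_n)=q=\lim_{J\to\infty}\liminf_{n\to\infty}\hat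 q_{J,p}(X_n),$$ where $q=\lim_{n\to\infty}\hat q_p(X_n)$ is the almost sure limit of the $p$th sample quantile from part 1. -/

import Mathlib

open Set Filter Topology MeasureTheory ProbabilityTheory

/-! ### Samples and embarrassingly parallel statistics -/

/-- Finite, nonempty multisets of elements of `𝕏`. -/
def Sample (𝕏 : Type*) : Type _ := {X : Multiset 𝕏 // X ≠ 0}

/-- The multiset `{x i : i ∈ b}`, with repetitions, for a nonempty finite set of indices `b`. -/
def subSample {𝕏 ι : Type*} (x : ι → 𝕏) (b : Finset ι) (hb : b.Nonempty) : Sample 𝕏 :=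
  ⟨b.val.map x, fun h => hb.ne_empty (Finset.val_eq_zero.1 (Multiset.map_eq_zero.1 h))⟩

/-- A statistic with values in `ℝ^d` is strongly embarrassingly parallel if, for every partition
of a finite nonempty index set into nonempty blocks, there is a function `F`, symmetric in its
arguments and not depending on the data, that computes the statistic of the whole sample from the
collection of its values on the blocks. -/
def IsSEP {𝕏 : Type*} {d : ℕ} (T : Sample 𝕏 → (Fin d → ℝ)) : Prop :=
  ∀ (n : ℕ) (hn : (Finset.univ : Finset (Fin n)).Nonempty)
    (I : Finpartition (Finset.univ : Finset (Fin n))),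
    ∃ F : (I.parts → (Fin d → ℝ)) → (Fin d → ℝ),
      (∀ (σ : Equiv.Perm I.parts) (v : I.parts → (Fin d → ℝ)), F (v ∘ σ) = F v) ∧
      ∀ x : Fin n → 𝕏,
        T (subSample x Finset.univ hn) =
          F (fun b => T (subSample x b.1 (I.nonempty_of_mem_parts b.2)))

/-- A statistic is weakly embarrassingly parallel if it is a function of finitely many strongly
embarrassingly parallel statistics. -/
def IsWEP {𝕏 E : Type*} (T : Sample 𝕏 → E) : Prop :=
  ∃ (L : ℕ) (d : Fin L → ℕ) (S : ∀ l : Fin L, Sample 𝕏 → (Fin (d l) → ℝ)),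
    (∀ l, IsSEP (S l)) ∧
    ∃ G : (∀ l : Fin L, Fin (d l) → ℝ) → E, ∀ X, T X = G (fun l => S l X)

/-- Finitely additively separable functions. -/
def IsFAS {𝕏 Θ : Type*} (Γ : 𝕏 → Θ → ℂ) : Prop :=
  ∃ (J : ℕ) (f : Fin J → 𝕏 → ℂ) (g : Fin J → Θ → ℂ) (η : Fin J → ℂ),
    ∀ x θ, Γ x θ = ∑ j, η j * f j x * g j θ

noncomputable section

/-- The sum `∑_{i} τ (x i)` over a sample. -/
def sumStat {𝕏 : Type*} (τ : 𝕏 → ℝ) (X : Sample 𝕏) : ℝ := (X.1.map τ).sum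

/-- The sample size `|X|`. -/
def size {𝕏 : Type*} (X : Sample 𝕏) : ℝ := (X.1.card : ℝ)

/-! ### Sample quantiles of data in `(0,1)` -/

/-- The empirical distribution function `F̂(X, θ)`. -/
def empCDF (X : Sample (Ioo (0 : ℝ) 1)) (θ : ℝ) : ℝ :=
  sumStat (fun t : Ioo (0 : ℝ) 1 => if (t : ℝ) ≤ θ then 1 else 0) X / size X

/-- The left-continuous empirical distribution function `F̂(X, θ⁻)`. -/
def empCDFLeft (X : Sample (Ioo (0 : ℝ) 1)) (θ : ℝ) : ℝ :=
  sumStat (fun t : Ioo (0 : ℝ) 1 => if (t : ℝ) < θ then 1 else 0) X / size X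

/-- The set of all `p`th sample quantiles of `X`. -/
def sampleQuantiles (p : ℝ) (X : Sample (Ioo (0 : ℝ) 1)) : Set ℝ :=
  {θ | θ ∈ Ioo (0 : ℝ) 1 ∧ empCDFLeft X θ ≤ p ∧ p ≤ empCDF X θ}

/-- The set of all minimizers of `G` over `[0,1]`. -/
def argminUnit (G : ℝ → ℝ) : Set ℝ :=
  {θ | θ ∈ Icc (0 : ℝ) 1 ∧ IsMinOn G (Icc (0 : ℝ) 1) θ}

/-- The check-loss objective `∑_i [|x_i - θ| / 2 + (p - 1/2) (x_i - θ)]`. -/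
def checkObjective (p : ℝ) (X : Sample (Ioo (0 : ℝ) 1)) (θ : ℝ) : ℝ :=
  sumStat (fun t : Ioo (0 : ℝ) 1 => 1 / 2 * |(t : ℝ) - θ| + (p - 1 / 2) * ((t : ℝ) - θ)) X

/-- The set of all check-loss M-estimators. -/
def checkMinimizers (p : ℝ) (X : Sample (Ioo (0 : ℝ) 1)) : Set ℝ :=
  argminUnit (checkObjective p X)

/-- The `J`-term Fourier truncation `|z|_J` of `|z|`; the summand with index `j` has frequency
`2 j + 1`, as `j` starts at `0`. -/
def fourierAbs (J : ℕ) (z : ℝ) : ℝ :=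
  Real.pi / 2 - 4 / Real.pi *
    ∑ j ∈ Finset.range J, Real.cos ((2 * (j : ℝ) + 1) * z) / (2 * (j : ℝ) + 1) ^ 2

/-- The check-loss objective with `|x_i - θ|` replaced by `|x_i - θ|_J`. -/
def approxObjective (J : ℕ) (p : ℝ) (X : Sample (Ioo (0 : ℝ) 1)) (θ : ℝ) : ℝ :=
  sumStat (fun t : Ioo (0 : ℝ) 1 => 1 / 2 * fourierAbs J ((t : ℝ) - θ) + (p - 1 / 2) * ((t : ℝ) - θ)) X

/-- The set of all minimizers over `[0,1]` of the approximate objective. -/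
def approxQuantiles (J : ℕ) (p : ℝ) (X : Sample (Ioo (0 : ℝ) 1)) : Set ℝ :=
  argminUnit (approxObjective J p X)

/-- The statistic `∑_i cos ((2 j + 1) x_i)`. -/
def cosStat (j : ℕ) (X : Sample (Ioo (0 : ℝ) 1)) : ℝ :=
  sumStat (fun t : Ioo (0 : ℝ) 1 => Real.cos ((2 * (j : ℝ) + 1) * (t : ℝ))) X

/-- The statistic `∑_i sin ((2 j + 1) x_i)`. -/
def sinStat (j : ℕ) (X : Sample (Ioo (0 : ℝ) 1)) : ℝ :=
  sumStat (fun t : Ioo (0 : ℝ) 1 => Real.sin ((2 * (j : ℝ) + 1) * (t : ℝ))) X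

/-! ### The law of the observations -/

/-- Lebesgue measure on `(0,1)`. -/
def lebesgueUnit : Measure (Ioo (0 : ℝ) 1) := (volume : Measure ℝ).comap Subtype.val

/-- `P` is absolutely continuous with respect to Lebesgue measure on `(0,1)`, with a density that
is positive almost everywhere on `(0,1)`. -/
def HasPositiveDensity (P : Measure (Ioo (0 : ℝ) 1)) : Prop :=
  P ≪ lebesgueUnit ∧ ∀ᵐ t ∂lebesgueUnit, 0 < P.rnDeriv lebesgueUnit t

/-- The derivative in `θ` of the `J`-term Fourier approximation to the distribution function:
`ζ_J(θ) = E[(2/π) ∑_{j=1}^{J} cos ((2 j - 1)(x - θ))]`. -/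
def zeta (P : Measure (Ioo (0 : ℝ) 1)) (J : ℕ) (θ : Ioo (0 : ℝ) 1) : ℝ :=
  ∫ t, 2 / Real.pi *
    ∑ j ∈ Finset.range J, Real.cos ((2 * (j : ℝ) + 1) * ((t : ℝ) - (θ : ℝ))) ∂P

/-- `ζ_J = E[(1/π) sin (2 J (x - θ)) / sin (x - θ)]` up to the removable singularity `x = θ`. -/
theorem two_div_pi_mul_sum_cos (J : ℕ) (z : ℝ) (hz : Real.sin z ≠ 0) :
    2 / Real.pi * ∑ j ∈ Finset.range J, Real.cos ((2 * (j : ℝ) + 1) * z) =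
      1 / Real.pi * (Real.sin (2 * J * z) / Real.sin z) := by
  have key : (∑ j ∈ Finset.range J, Real.cos ((2 * (j : ℝ) + 1) * z)) * (2 * Real.sin z) =
      Real.sin (2 * J * z) := by
    induction J with
    | zero => simp
    | succ k ih =>
      rw [Finset.sum_range_succ, add_mul, ih]
      have h1 : (2 * ((k + 1 : ℕ) : ℝ) * z) = (2 * (k : ℝ) + 1) * z + z := by push_cast; ring
      have h2 : (2 * (k : ℝ) * z) = (2 * (k : ℝ) + 1) * z - z := by ring
      rw [h1, h2, Real.sin_add, Real.sin_sub]
      ring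
  rw [← key, mul_div_assoc, mul_div_assoc, div_self hz]
  ring

/-- `ζ_J` converges, uniformly on `(0,1)`, to (a version of) the density of `P`. -/
def ZetaTendstoDensity (P : Measure (Ioo (0 : ℝ) 1)) : Prop :=
  ∃ f : Ioo (0 : ℝ) 1 → ℝ,
    (f =ᵐ[lebesgueUnit] fun t => (P.rnDeriv lebesgueUnit t).toReal) ∧
    TendstoUniformly (fun (J : ℕ) (θ : Ioo (0 : ℝ) 1) => zeta P J θ) f atTop

/-- The sample `{x 0, …, x n}` of the first `n + 1` observations. -/
def firstObs {𝕏 : Type*} (x : ℕ → 𝕏) (n : ℕ) : Sample 𝕏 :=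
  subSample x (Finset.range (n + 1)) ⟨0, Finset.mem_range.2 n.succ_pos⟩

end

/-!
All estimators in question nearly minimize the mean check loss, and the mean check loss separates
its minimizers from the quantile `q` of the law; no uniform law of large numbers is needed.

The check loss is convex in `θ`, and `1[t ≤ θ] - p` and `1[t < θ] - p` are subgradients of it at
`θ`. Summing over a sample, the conditions `F̂(θ⁻) ≤ p ≤ F̂(θ)` are the first-order conditions for a
minimizer, so that sample quantiles are exactly the check-loss minimizers
(`sampleQuantiles_eq_checkMinimizers`). The endpoints of `[0, 1]` never minimize since `0 < p < 1`.
Two distinct sample quantiles force `F̂ = p` at the smaller one, which makes `p |X|` an integer.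

The distribution function `F` of a law with positive density is continuous and strictly increasing
on `[0, 1]`, hence `F(q) = p` for some `q`, and `F(r) ≠ p` for `r ≠ q`. Almost surely the empirical
distribution functions converge to `F` at `q` and at all rationals. For a rational `r` between `q`
and `q ± ε`, the subgradient inequalities at `q` and at `r` bound the excess of the mean check loss
over its value at `q` away from zero outside `(q - ε, q + ε)`, for all large samples
(`exists_eventually_lt_of_le_abs_sub`). So sample quantiles converge to `q`.

The series `|z|_J` converges to `|z|` uniformly on `[-1, 1]` (`eventually_abs_fourierAbs_sub_abs_le`):
its coefficients are absolutely summable, and its sum is the odd part of the cosine series of the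
second Bernoulli polynomial. Consequently the approximate and the exact mean objectives differ by an
amount that is small uniformly in `θ` and in the sample, every minimizer of the approximate objective
minimizes the mean check loss up to such an amount, and the same separation puts it close to `q`.

Finally, `cos (a (t - θ))` splits by the addition theorem into products of functions of `t` and of
`θ`. This gives additive separability, and it shows that, up to a term not depending on `θ`, the
approximate objective is determined by the sample size and the trigonometric sums
(`approxQuantiles_eq`), all of which are sums over the sample and therefore SEP (`isSEP_sumStat`).
-/

/-! ### Sums over samples and embarrassingly parallel statistics -/

theorem sumStat_subSample {𝕏 ι : Type*} (τ : 𝕏 → ℝ) (x : ι → 𝕏) (b : Finset ι) (hb : b.Nonempty) :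
    sumStat τ (subSample x b hb) = ∑ i ∈ b, τ (x i) := by
  simp only [sumStat, subSample, Multiset.map_map]
  rfl

theorem sumStat_firstObs {𝕏 : Type*} (τ : 𝕏 → ℝ) (x : ℕ → 𝕏) (n : ℕ) :
    sumStat τ (firstObs x n) = ∑ i ∈ Finset.range (n + 1), τ (x i) :=
  sumStat_subSample _ _ _ _

theorem sumStat_add {𝕏 : Type*} (σ τ : 𝕏 → ℝ) (X : Sample 𝕏) :
    sumStat (fun t => σ t + τ t) X = sumStat σ X + sumStat τ X :=
  Multiset.sum_map_add

theorem sumStat_sub {𝕏 : Type*} (σ τ : 𝕏 → ℝ) (X : Sample 𝕏) :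
    sumStat (fun t => σ t - τ t) X = sumStat σ X - sumStat τ X :=
  Multiset.sum_map_sub

theorem sumStat_const_mul {𝕏 : Type*} (c : ℝ) (τ : 𝕏 → ℝ) (X : Sample 𝕏) :
    sumStat (fun t => c * τ t) X = c * sumStat τ X :=
  Multiset.sum_map_mul_left

theorem sumStat_const {𝕏 : Type*} (c : ℝ) (X : Sample 𝕏) :
    sumStat (fun _ => c) X = c * size X := by
  simp [sumStat, size, mul_comm]

theorem sumStat_finsetSum {𝕏 ι : Type*} (s : Finset ι) (τ : ι → 𝕏 → ℝ) (X : Sample 𝕏) :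
    sumStat (fun t => ∑ j ∈ s, τ j t) X = ∑ j ∈ s, sumStat (τ j) X := by
  classical
  induction s using Finset.induction_on with
  | empty => simp [sumStat]
  | insert a s ha ih => simp only [Finset.sum_insert ha, sumStat_add, ih]

theorem sumStat_le_sumStat {𝕏 : Type*} {σ τ : 𝕏 → ℝ} {X : Sample 𝕏}
    (h : ∀ t ∈ X.1, σ t ≤ τ t) : sumStat σ X ≤ sumStat τ X :=
  Multiset.sum_map_le_sum_map _ _ h

theorem sumStat_indicator_eq_card {𝕏 : Type*} (A : 𝕏 → Prop) [DecidablePred A] (X : Sample 𝕏) :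
    sumStat (fun t => if A t then 1 else 0) X = ((X.1.filter A).card : ℝ) := by
  unfold sumStat
  induction X.1 using Multiset.induction_on with
  | empty => simp
  | cons a s ih => by_cases h : A a <;> simp [h, ih, add_comm]

theorem size_pos {𝕏 : Type*} (X : Sample 𝕏) : 0 < size X :=
  Nat.cast_pos.2 (Multiset.card_pos.2 X.2)

theorem size_firstObs {𝕏 : Type*} (x : ℕ → 𝕏) (n : ℕ) : size (firstObs x n) = n + 1 := by
  simp [size, firstObs, subSample]

theorem isSEP_sumStat {𝕏 : Type*} (τ : 𝕏 → ℝ) :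
    IsSEP (fun (X : Sample 𝕏) (_ : Fin 1) => sumStat τ X) := by
  intro n hn I
  refine ⟨fun v => ∑ b, v b, fun σ v => Equiv.sum_comp σ v, fun x => ?_⟩
  funext k
  simp only [Finset.sum_apply, sumStat_subSample]
  rw [Finset.sum_coe_sort I.parts (fun b => ∑ i ∈ b, τ (x i))]
  exact (congrArg (fun s => ∑ i ∈ s, τ (x i)) I.biUnion_parts).symm.trans
    (Finset.sum_biUnion I.disjoint)

theorem size_eq_sumStat {𝕏 : Type*} : (size : Sample 𝕏 → ℝ) = sumStat (fun _ => 1) := by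
  funext X; simp [sumStat_const]

/-- A function of a finite family of real-valued SEP statistics is WEP. -/
theorem IsWEP.of_isSEP {𝕏 E ι : Type*} [Fintype ι] (S : ι → Sample 𝕏 → ℝ)
    (hS : ∀ i, IsSEP (fun X (_ : Fin 1) => S i X)) (G : (ι → ℝ) → E) :
    IsWEP (fun X => G (fun i => S i X)) := by
  let e := Fintype.equivFin ι
  exact ⟨Fintype.card ι, fun _ => 1, fun l X _ => S (e.symm l) X, fun l => hS _,
    fun v => G (fun i => v (e i) 0), fun X => by simp⟩

/-! ### Additive separability -/

theorem IsFAS.mul {𝕏 Θ : Type*} (f : 𝕏 → ℂ) (g : Θ → ℂ) : IsFAS (fun t θ => f t * g θ) :=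
  ⟨1, fun _ => f, fun _ => g, fun _ => 1, fun t θ => by simp⟩

theorem IsFAS.add {𝕏 Θ : Type*} {Γ Δ : 𝕏 → Θ → ℂ} (hΓ : IsFAS Γ) (hΔ : IsFAS Δ) :
    IsFAS (fun t θ => Γ t θ + Δ t θ) := by
  obtain ⟨J, f, g, η, h⟩ := hΓ
  obtain ⟨K, f', g', η', h'⟩ := hΔ
  refine ⟨J + K, Fin.append f f', Fin.append g g', Fin.append η η', fun t θ => ?_⟩
  simp [Fin.sum_univ_add, h, h']

theorem cos_mul_sub (a t θ : ℝ) :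
    Real.cos (a * (t - θ)) =
      Real.cos (a * t) * Real.cos (a * θ) + Real.sin (a * t) * Real.sin (a * θ) := by
  rw [mul_sub, Real.cos_sub]

theorem fourierAbs_succ (J : ℕ) (z : ℝ) :
    fourierAbs (J + 1) z = fourierAbs J z -
      4 / Real.pi * (Real.cos ((2 * (J : ℝ) + 1) * z) / (2 * (J : ℝ) + 1) ^ 2) := by
  rw [fourierAbs, fourierAbs, Finset.sum_range_succ]; ring

theorem isFAS_fourierAbs (J : ℕ) : IsFAS (fun t θ : ℝ => (fourierAbs J (t - θ) : ℂ)) := by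
  induction J with
  | zero =>
    convert IsFAS.mul (fun _ : ℝ => ((Real.pi / 2 : ℝ) : ℂ)) (fun _ : ℝ => 1) using 3
    simp [fourierAbs]
  | succ J ih =>
    set a : ℝ := 2 * (J : ℝ) + 1 with ha
    convert (ih.add (IsFAS.mul (fun t : ℝ => ((-(4 / Real.pi / a ^ 2) * Real.cos (a * t) : ℝ) : ℂ))
      (fun θ : ℝ => (Real.cos (a * θ) : ℂ)))).add
      (IsFAS.mul (fun t : ℝ => ((-(4 / Real.pi / a ^ 2) * Real.sin (a * t) : ℝ) : ℂ))
      (fun θ : ℝ => (Real.sin (a * θ) : ℂ))) using 3 with t θ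
    rw [fourierAbs_succ, ← ha, cos_mul_sub]
    push_cast
    ring

/-! ### The approximate objective as a function of trigonometric sums -/

theorem argminUnit_add_const (H : ℝ → ℝ) (c : ℝ) :
    argminUnit (fun θ => H θ + c) = argminUnit H := by
  simp [argminUnit, isMinOn_iff]

theorem argminUnit_nonempty {H : ℝ → ℝ} (hH : Continuous H) : (argminUnit H).Nonempty := by
  obtain ⟨θ, hθ, hmin⟩ :=
    isCompact_Icc.exists_isMinOn (nonempty_Icc.2 (zero_le_one' ℝ)) hH.continuousOn
  exact ⟨θ, hθ, hmin⟩

/-- The part of the approximate objective that depends on `θ`, written in terms of the sample size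
`n` and of the trigonometric sums `c j = ∑ cos ((2 j + 1) x_i)`, `s j = ∑ sin ((2 j + 1) x_i)`. -/
noncomputable def trigObjective (J : ℕ) (p n : ℝ) (c s : Fin J → ℝ) (θ : ℝ) : ℝ :=
  Real.pi / 4 * n - 2 / Real.pi * (∑ j : Fin J,
    (Real.cos ((2 * (j : ℝ) + 1) * θ) * c j + Real.sin ((2 * (j : ℝ) + 1) * θ) * s j) /
      (2 * (j : ℝ) + 1) ^ 2) - (p - 1 / 2) * (n * θ)

theorem approxObjective_eq (J : ℕ) (p : ℝ) (X : Sample (Ioo (0 : ℝ) 1)) (θ : ℝ) :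
    approxObjective J p X θ =
      trigObjective J p (size X) (fun j => cosStat j X) (fun j => sinStat j X) θ +
        (p - 1 / 2) * sumStat (fun t : Ioo (0 : ℝ) 1 => (t : ℝ)) X := by
  have h : ∀ t : Ioo (0 : ℝ) 1,
      1 / 2 * fourierAbs J ((t : ℝ) - θ) + (p - 1 / 2) * ((t : ℝ) - θ) =
      ((Real.pi / 4 - (p - 1 / 2) * θ) - 2 / Real.pi * ∑ j ∈ Finset.range J,
        (Real.cos ((2 * (j : ℝ) + 1) * θ) / (2 * (j : ℝ) + 1) ^ 2 *
          Real.cos ((2 * (j : ℝ) + 1) * t) +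
        Real.sin ((2 * (j : ℝ) + 1) * θ) / (2 * (j : ℝ) + 1) ^ 2 *
          Real.sin ((2 * (j : ℝ) + 1) * t))) + (p - 1 / 2) * t := by
    intro t
    have e : ∑ j ∈ Finset.range J,
        Real.cos ((2 * (j : ℝ) + 1) * ((t : ℝ) - θ)) / (2 * (j : ℝ) + 1) ^ 2 =
        ∑ j ∈ Finset.range J,
        (Real.cos ((2 * (j : ℝ) + 1) * θ) / (2 * (j : ℝ) + 1) ^ 2 *
          Real.cos ((2 * (j : ℝ) + 1) * t) +
        Real.sin ((2 * (j : ℝ) + 1) * θ) / (2 * (j : ℝ) + 1) ^ 2 *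
          Real.sin ((2 * (j : ℝ) + 1) * t)) :=
      Finset.sum_congr rfl fun j _ => by rw [cos_mul_sub]; ring
    rw [fourierAbs, e]
    ring
  have e : ∑ j : Fin J,
      (Real.cos ((2 * (j : ℝ) + 1) * θ) * cosStat j X +
        Real.sin ((2 * (j : ℝ) + 1) * θ) * sinStat j X) / (2 * (j : ℝ) + 1) ^ 2 =
      ∑ j ∈ Finset.range J,
        (Real.cos ((2 * (j : ℝ) + 1) * θ) / (2 * (j : ℝ) + 1) ^ 2 * cosStat j X +
        Real.sin ((2 * (j : ℝ) + 1) * θ) / (2 * (j : ℝ) + 1) ^ 2 * sinStat j X) := by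
    rw [← Fin.sum_univ_eq_sum_range (fun j : ℕ =>
      (Real.cos ((2 * (j : ℝ) + 1) * θ) / (2 * (j : ℝ) + 1) ^ 2 * cosStat j X +
        Real.sin ((2 * (j : ℝ) + 1) * θ) / (2 * (j : ℝ) + 1) ^ 2 * sinStat j X))]
    exact Finset.sum_congr rfl fun j _ => by ring
  simp only [approxObjective, h, sumStat_add, sumStat_sub, sumStat_const, sumStat_const_mul,
    sumStat_finsetSum]
  rw [trigObjective, e]
  simp only [cosStat, sinStat]
  ring

theorem approxQuantiles_eq (J : ℕ) (p : ℝ) (X : Sample (Ioo (0 : ℝ) 1)) :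
    approxQuantiles J p X = argminUnit
      (trigObjective J p (size X) (fun j => cosStat j X) (fun j => sinStat j X)) := by
  rw [approxQuantiles, funext (approxObjective_eq J p X), argminUnit_add_const]

theorem approxQuantiles_nonempty (J : ℕ) (p : ℝ) (X : Sample (Ioo (0 : ℝ) 1)) :
    (approxQuantiles J p X).Nonempty := by
  rw [approxQuantiles_eq]
  exact argminUnit_nonempty (by unfold trigObjective; fun_prop)

theorem isSEP_size : IsSEP (fun (X : Sample (Ioo (0 : ℝ) 1)) (_ : Fin 1) => size X) := by
  rw [size_eq_sumStat]; exact isSEP_sumStat _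

theorem isWEP_comp_approxQuantiles {E : Type*} (J : ℕ) (p : ℝ) (φ : Set ℝ → E) :
    IsWEP (fun X => φ (approxQuantiles J p X)) := by
  simp only [approxQuantiles_eq]
  exact IsWEP.of_isSEP (ι := Option (Fin J ⊕ Fin J))
    (fun i X => i.elim (size X) (Sum.elim (fun j => cosStat j X) (fun j => sinStat j X)))
    (by
      rintro (_ | j | j)
      · exact isSEP_size
      · exact isSEP_sumStat _
      · exact isSEP_sumStat _)
    (fun v => φ (argminUnit (trigObjective J p (v none) (fun j => v (some (.inl j)))
      (fun j => v (some (.inr j))))))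

/-! ### The Fourier series of the absolute value -/

theorem hasSum_cos_div_sq {x : ℝ} (hx : x ∈ Icc (0 : ℝ) 1) :
    HasSum (fun n : ℕ => Real.cos (2 * Real.pi * n * x) / (n : ℝ) ^ 2)
      (Real.pi ^ 2 * (x ^ 2 - x + 6⁻¹)) := by
  convert! hasSum_one_div_nat_pow_mul_cos one_ne_zero hx using 1
  · funext n; simp; ring
  · change _ = _ * bernoulliFun (2 * 1) x
    rw [mul_one, bernoulliFun_two]
    norm_num [Nat.factorial]
    left
    ring

theorem summable_one_div_odd_sq : Summable (fun j : ℕ => 1 / (2 * (j : ℝ) + 1) ^ 2) := by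
  have h := (Real.summable_one_div_nat_pow.2 one_lt_two).comp_injective
    (i := fun j : ℕ => 2 * j + 1) (fun a b h => by simpa using h)
  refine h.congr fun j => ?_
  simp

theorem norm_cos_div_odd_sq_le (j : ℕ) (z : ℝ) :
    ‖Real.cos ((2 * (j : ℝ) + 1) * z) / (2 * (j : ℝ) + 1) ^ 2‖ ≤ 1 / (2 * (j : ℝ) + 1) ^ 2 := by
  rw [norm_div, Real.norm_of_nonneg (sq_nonneg (2 * (j : ℝ) + 1))]
  gcongr
  exact Real.abs_cos_le_one _

/-- The odd part of the cosine series of the second Bernoulli polynomial: the full series at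
`z / (2π)` minus its even part, which is a quarter of the series at `z / π`. -/
theorem tsum_cos_div_odd_sq {z : ℝ} (hz : |z| ≤ Real.pi) :
    ∑' j : ℕ, Real.cos ((2 * (j : ℝ) + 1) * z) / (2 * (j : ℝ) + 1) ^ 2 =
      Real.pi ^ 2 / 8 - Real.pi / 4 * |z| := by
  have hpi := Real.pi_pos
  wlog h0 : 0 ≤ z generalizing z
  · rw [← abs_neg, ← this (by rwa [abs_neg]) (by linarith)]
    simp
  rw [abs_of_nonneg h0] at hz ⊢
  have hfull := hasSum_cos_div_sq (x := z / (2 * Real.pi))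
    ⟨by positivity, (div_le_one (by positivity)).2 (by linarith)⟩
  have heven := (hasSum_cos_div_sq (x := z / Real.pi)
    ⟨by positivity, (div_le_one hpi).2 hz⟩).mul_left (1 / 4)
  have hodd := (Summable.of_norm_bounded summable_one_div_odd_sq
    (fun j => norm_cos_div_odd_sq_le j z)).hasSum
  have hsum := HasSum.even_add_odd
    (f := fun n : ℕ => Real.cos (2 * Real.pi * n * (z / (2 * Real.pi))) / (n : ℝ) ^ 2)
    (by
      convert! heven using 1
      funext k
      have : 2 * Real.pi * ((2 * k : ℕ) : ℝ) * (z / (2 * Real.pi)) =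
          2 * Real.pi * k * (z / Real.pi) := by push_cast; field_simp
      rw [this]; push_cast; ring)
    (by
      convert! hodd using 1
      funext k
      have : 2 * Real.pi * ((2 * k + 1 : ℕ) : ℝ) * (z / (2 * Real.pi)) =
          (2 * (k : ℝ) + 1) * z := by push_cast; field_simp
      rw [this]; push_cast; ring)
  have := hfull.unique hsum
  rw [← sub_eq_iff_eq_add'] at this
  rw [← this]
  field_simp
  ring

/-- `|z|_J → |z|` uniformly on `[-1, 1]`, by the absolute convergence of the Fourier series. -/
theorem eventually_abs_fourierAbs_sub_abs_le {c : ℝ} (hc : 0 < c) :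
    ∀ᶠ J in atTop, ∀ z : ℝ, |z| ≤ 1 → dist (fourierAbs J z) |z| ≤ c := by
  have hpi := Real.pi_pos
  have hu := tendstoUniformly_tsum_nat summable_one_div_odd_sq norm_cos_div_odd_sq_le
  filter_upwards [Metric.tendstoUniformly_iff.1 hu (c * Real.pi / 4) (by positivity)] with J hJ z hz
  have h := hJ z
  rw [tsum_cos_div_odd_sq (hz.trans (by linarith [Real.pi_gt_three])), Real.dist_eq] at h
  set S := ∑ j ∈ Finset.range J, Real.cos ((2 * (j : ℝ) + 1) * z) / (2 * (j : ℝ) + 1) ^ 2 with hS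
  have e : fourierAbs J z - |z| =
      4 / Real.pi * (Real.pi ^ 2 / 8 - Real.pi / 4 * |z| - S) := by
    rw [fourierAbs, ← hS]; field_simp; ring
  rw [Real.dist_eq, e, abs_mul, abs_of_pos (by positivity : 0 < 4 / Real.pi)]
  calc 4 / Real.pi * _ ≤ 4 / Real.pi * (c * Real.pi / 4) := by gcongr
    _ = c := by field_simp

/-! ### The check loss -/

/-- The check loss `ρ(t, θ) = |t - θ| / 2 + (p - 1/2) (t - θ)`. -/
noncomputable def checkLoss (p t θ : ℝ) : ℝ := 1 / 2 * |t - θ| + (p - 1 / 2) * (t - θ)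

/-- `1[t ≤ θ] - p` is a subgradient of the check loss at `θ`. -/
theorem checkLoss_sub_ge (p t θ θ' : ℝ) :
    (θ' - θ) * ((if t ≤ θ then 1 else 0) - p) ≤ checkLoss p t θ' - checkLoss p t θ := by
  unfold checkLoss
  split_ifs with h
  · rw [abs_of_nonpos (by linarith : t - θ ≤ 0)]
    linarith [neg_abs_le (t - θ')]
  · rw [abs_of_pos (by linarith : 0 < t - θ)]
    linarith [le_abs_self (t - θ')]

/-- `1[t < θ] - p` is a subgradient of the check loss at `θ`. -/
theorem checkLoss_sub_ge_of_lt (p t θ θ' : ℝ) :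
    (θ' - θ) * ((if t < θ then 1 else 0) - p) ≤ checkLoss p t θ' - checkLoss p t θ := by
  unfold checkLoss
  split_ifs with h
  · rw [abs_of_nonpos (by linarith : t - θ ≤ 0)]
    linarith [neg_abs_le (t - θ')]
  · rw [abs_of_nonneg (by linarith : 0 ≤ t - θ)]
    linarith [le_abs_self (t - θ')]

theorem checkLoss_sub_eq_right {p t θ θ' : ℝ} (hlt : θ < θ') (h : t ≤ θ ∨ θ' ≤ t) :
    checkLoss p t θ' - checkLoss p t θ = (θ' - θ) * ((if t ≤ θ then 1 else 0) - p) := by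
  unfold checkLoss
  split_ifs with h'
  · rw [abs_of_nonpos (by linarith : t - θ ≤ 0), abs_of_nonpos (by linarith : t - θ' ≤ 0)]
    ring
  · have := h.resolve_left h'
    rw [abs_of_nonneg (by linarith : 0 ≤ t - θ), abs_of_nonneg (by linarith : 0 ≤ t - θ')]
    ring

theorem checkLoss_sub_eq_left {p t θ θ' : ℝ} (hlt : θ' < θ) (h : t ≤ θ' ∨ θ ≤ t) :
    checkLoss p t θ' - checkLoss p t θ = (θ' - θ) * ((if t < θ then 1 else 0) - p) := by
  unfold checkLoss
  split_ifs with h'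
  · have := h.resolve_right (not_le.2 h')
    rw [abs_of_nonpos (by linarith : t - θ ≤ 0), abs_of_nonpos (by linarith : t - θ' ≤ 0)]
    ring
  · rw [abs_of_nonneg (by linarith : 0 ≤ t - θ), abs_of_nonneg (by linarith : 0 ≤ t - θ')]
    ring

section Sample

variable {p : ℝ} {X : Sample (Ioo (0 : ℝ) 1)} {θ θ' : ℝ}

theorem checkObjective_sub (p : ℝ) (X : Sample (Ioo (0 : ℝ) 1)) (θ θ' : ℝ) :
    checkObjective p X θ' - checkObjective p X θ =
      sumStat (fun t : Ioo (0 : ℝ) 1 => checkLoss p t θ' - checkLoss p t θ) X :=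
  (sumStat_sub _ _ X).symm

theorem sumStat_empCDF (p : ℝ) (X : Sample (Ioo (0 : ℝ) 1)) (θ d : ℝ) :
    sumStat (fun t : Ioo (0 : ℝ) 1 => d * ((if (t : ℝ) ≤ θ then 1 else 0) - p)) X =
      size X * (d * (empCDF X θ - p)) := by
  rw [sumStat_const_mul, sumStat_sub, sumStat_const, empCDF]
  field_simp [(size_pos X).ne']

theorem sumStat_empCDFLeft (p : ℝ) (X : Sample (Ioo (0 : ℝ) 1)) (θ d : ℝ) :
    sumStat (fun t : Ioo (0 : ℝ) 1 => d * ((if (t : ℝ) < θ then 1 else 0) - p)) X =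
      size X * (d * (empCDFLeft X θ - p)) := by
  rw [sumStat_const_mul, sumStat_sub, sumStat_const, empCDFLeft]
  field_simp [(size_pos X).ne']

theorem checkObjective_sub_ge (p : ℝ) (X : Sample (Ioo (0 : ℝ) 1)) (θ θ' : ℝ) :
    size X * ((θ' - θ) * (empCDF X θ - p)) ≤ checkObjective p X θ' - checkObjective p X θ := by
  rw [checkObjective_sub, ← sumStat_empCDF]
  exact sumStat_le_sumStat fun t _ => checkLoss_sub_ge _ _ _ _

theorem checkObjective_sub_ge_of_left (p : ℝ) (X : Sample (Ioo (0 : ℝ) 1)) (θ θ' : ℝ) :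
    size X * ((θ' - θ) * (empCDFLeft X θ - p)) ≤
      checkObjective p X θ' - checkObjective p X θ := by
  rw [checkObjective_sub, ← sumStat_empCDFLeft]
  exact sumStat_le_sumStat fun t _ => checkLoss_sub_ge_of_lt _ _ _ _

/-! ### Sample quantiles as minimizers of the check loss -/

theorem empCDF_le_empCDFLeft (h : θ < θ') : empCDF X θ ≤ empCDFLeft X θ' := by
  unfold empCDF empCDFLeft
  have := (size_pos X).le
  gcongr
  refine sumStat_le_sumStat fun t _ => ?_
  split_ifs <;> linarith

theorem empCDF_of_le_zero (h : θ ≤ 0) : empCDF X θ = 0 := by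
  have : ∀ t : Ioo (0 : ℝ) 1, ¬ (t : ℝ) ≤ θ := fun t => not_le.2 (h.trans_lt t.2.1)
  simp [empCDF, this, sumStat_const]

theorem empCDF_of_one_le (h : 1 ≤ θ) : empCDF X θ = 1 := by
  have : ∀ t : Ioo (0 : ℝ) 1, (t : ℝ) ≤ θ := fun t => t.2.2.le.trans h
  simp [empCDF, this, sumStat_const, (size_pos X).ne']

theorem empCDFLeft_of_le_zero (h : θ ≤ 0) : empCDFLeft X θ = 0 := by
  have : ∀ t : Ioo (0 : ℝ) 1, ¬ (t : ℝ) < θ := fun t => not_lt.2 (h.trans t.2.1.le)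
  simp [empCDFLeft, this, sumStat_const]

theorem empCDFLeft_of_one_le (h : 1 ≤ θ) : empCDFLeft X θ = 1 := by
  have : ∀ t : Ioo (0 : ℝ) 1, (t : ℝ) < θ := fun t => t.2.2.trans_le h
  simp [empCDFLeft, this, sumStat_const, (size_pos X).ne']

/-- Immediately to the right of `θ` there are no data, so that the objective is linear there. -/
theorem exists_gap_right (X : Sample (Ioo (0 : ℝ) 1)) (h : θ < 1) :
    ∃ θ' ∈ Ioc θ 1, ∀ t ∈ X.1, (t : ℝ) ≤ θ ∨ θ' ≤ t := by
  have h1 : ∀ᶠ θ' : ℝ in 𝓝[>] θ, ∀ t ∈ {t | t ∈ X.1}, (t : ℝ) ≤ θ ∨ θ' ≤ t := by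
    refine (Filter.eventually_all_finite (Multiset.finite_toSet X.1)).2 fun t _ => ?_
    rcases le_or_gt (t : ℝ) θ with ht | ht
    · exact Eventually.of_forall fun _ => Or.inl ht
    · filter_upwards [Ioc_mem_nhdsGT ht] with θ' hθ' using Or.inr hθ'.2
  obtain ⟨θ', hθ', hm⟩ := (h1.and (Ioc_mem_nhdsGT h)).exists
  exact ⟨θ', hm, hθ'⟩

/-- Immediately to the left of `θ` there are no data, so that the objective is linear there. -/
theorem exists_gap_left (X : Sample (Ioo (0 : ℝ) 1)) (h : 0 < θ) :
    ∃ θ' ∈ Ico 0 θ, ∀ t ∈ X.1, (t : ℝ) ≤ θ' ∨ θ ≤ t := by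
  have h1 : ∀ᶠ θ' : ℝ in 𝓝[<] θ, ∀ t ∈ {t | t ∈ X.1}, (t : ℝ) ≤ θ' ∨ θ ≤ t := by
    refine (Filter.eventually_all_finite (Multiset.finite_toSet X.1)).2 fun t _ => ?_
    rcases le_or_gt θ (t : ℝ) with ht | ht
    · exact Eventually.of_forall fun _ => Or.inr ht
    · filter_upwards [Ico_mem_nhdsLT ht] with θ' hθ' using Or.inl hθ'.1
  obtain ⟨θ', hθ', hm⟩ := (h1.and (Ico_mem_nhdsLT h)).exists
  exact ⟨θ', hm, hθ'⟩

theorem le_empCDF_of_mem_checkMinimizers (hp : p ≤ 1) (h : θ ∈ checkMinimizers p X) :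
    p ≤ empCDF X θ := by
  rcases lt_or_ge θ 1 with h1 | h1
  · obtain ⟨θ', hθ', hgap⟩ := exists_gap_right X h1
    have hmin := isMinOn_iff.1 h.2 θ' ⟨h.1.1.trans hθ'.1.le, hθ'.2⟩
    have hle : checkObjective p X θ' - checkObjective p X θ ≤
        size X * ((θ' - θ) * (empCDF X θ - p)) := by
      rw [checkObjective_sub, ← sumStat_empCDF]
      exact sumStat_le_sumStat fun t ht => (checkLoss_sub_eq_right hθ'.1 (hgap t ht)).le
    have h0 : 0 ≤ size X * ((θ' - θ) * (empCDF X θ - p)) := by linarith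
    linarith [nonneg_of_mul_nonneg_right (nonneg_of_mul_nonneg_right h0 (size_pos X))
      (sub_pos.2 hθ'.1)]
  · rwa [empCDF_of_one_le h1]

theorem empCDFLeft_le_of_mem_checkMinimizers (hp : 0 ≤ p) (h : θ ∈ checkMinimizers p X) :
    empCDFLeft X θ ≤ p := by
  rcases lt_or_ge 0 θ with h1 | h1
  · obtain ⟨θ', hθ', hgap⟩ := exists_gap_left X h1
    have hmin := isMinOn_iff.1 h.2 θ' ⟨hθ'.1, hθ'.2.le.trans h.1.2⟩
    have hle : checkObjective p X θ' - checkObjective p X θ ≤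
        size X * ((θ' - θ) * (empCDFLeft X θ - p)) := by
      rw [checkObjective_sub, ← sumStat_empCDFLeft]
      exact sumStat_le_sumStat fun t ht => (checkLoss_sub_eq_left hθ'.2 (hgap t ht)).le
    have h0 : 0 ≤ size X * ((θ' - θ) * (empCDFLeft X θ - p)) := by linarith
    have h2 := nonneg_of_mul_nonneg_right h0 (size_pos X)
    have h3 : 0 ≤ (θ - θ') * (p - empCDFLeft X θ) := by linarith
    linarith [nonneg_of_mul_nonneg_right h3 (sub_pos.2 hθ'.2)]
  · rwa [empCDFLeft_of_le_zero h1]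

/-- First-order conditions for the convex check-loss objective. The endpoints of `[0, 1]` are not
minimizers, because all data lie in the open interval and `0 < p < 1`. -/
theorem sampleQuantiles_eq_checkMinimizers (hp : p ∈ Ioo (0 : ℝ) 1)
    (X : Sample (Ioo (0 : ℝ) 1)) : sampleQuantiles p X = checkMinimizers p X := by
  ext θ
  constructor
  · rintro ⟨hθ, h1, h2⟩
    refine ⟨Ioo_subset_Icc_self hθ, isMinOn_iff.2 fun θ' _ => ?_⟩
    have hs := size_pos X
    rcases le_total θ θ' with h | h
    · have := checkObjective_sub_ge p X θ θ'
      have := mul_nonneg hs.le (mul_nonneg (sub_nonneg.2 h) (sub_nonneg.2 h2))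
      linarith
    · have := checkObjective_sub_ge_of_left p X θ θ'
      have := mul_nonneg hs.le (mul_nonneg (sub_nonneg.2 h) (sub_nonneg.2 h1))
      linarith
  · intro h
    have h1 := le_empCDF_of_mem_checkMinimizers hp.2.le h
    have h2 := empCDFLeft_le_of_mem_checkMinimizers hp.1.le h
    refine ⟨⟨?_, ?_⟩, h2, h1⟩
    · by_contra! h0
      rw [empCDF_of_le_zero h0] at h1
      linarith [hp.1]
    · by_contra! h0
      rw [empCDFLeft_of_one_le h0] at h2
      linarith [hp.2]

theorem sampleQuantiles_nonempty (hp : p ∈ Ioo (0 : ℝ) 1) (X : Sample (Ioo (0 : ℝ) 1)) :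
    (sampleQuantiles p X).Nonempty := by
  rw [sampleQuantiles_eq_checkMinimizers hp]
  refine argminUnit_nonempty ?_
  change Continuous fun θ => checkObjective p X θ
  simp only [checkObjective, sumStat]
  refine continuous_multiset_sum _ fun t _ => ?_
  fun_prop

/-- Two distinct quantiles `θ < θ'` force `F̂(θ) = p`, an integer multiple of `1 / |X|`. -/
theorem exists_size_mul_eq_nat (hθ : θ ∈ sampleQuantiles p X) (hθ' : θ' ∈ sampleQuantiles p X)
    (h : θ < θ') : ∃ k : ℕ, size X * p = k := by
  have hp : empCDF X θ = p := le_antisymm ((empCDF_le_empCDFLeft h).trans hθ'.2.1) hθ.2.2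
  rw [← hp, empCDF, mul_div_cancel₀ _ (size_pos X).ne', sumStat_indicator_eq_card]
  exact ⟨_, rfl⟩

theorem existsUnique_sampleQuantiles (hp : p ∈ Ioo (0 : ℝ) 1)
    (h : ¬ ∃ k : ℕ, size X * p = k) : ∃! θ, θ ∈ sampleQuantiles p X := by
  obtain ⟨θ, hθ⟩ := sampleQuantiles_nonempty hp X
  refine ⟨θ, hθ, fun θ' hθ' => ?_⟩
  by_contra hne
  rcases lt_or_gt_of_ne hne with h' | h'
  · exact h (exists_size_mul_eq_nat hθ' hθ h')
  · exact h (exists_size_mul_eq_nat hθ hθ' h')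

/-- Minimizers of the approximate objective nearly minimize the check-loss objective. -/
theorem checkObjective_sub_le_of_mem_approxQuantiles {J : ℕ} {c q : ℝ}
    (hJ : ∀ z : ℝ, |z| ≤ 1 → dist (fourierAbs J z) |z| ≤ c) (hq : q ∈ Icc (0 : ℝ) 1)
    (hθ : θ ∈ approxQuantiles J p X) :
    checkObjective p X θ - checkObjective p X q ≤ size X * c := by
  have hmin := isMinOn_iff.1 hθ.2 q hq
  have hz : ∀ (t : Ioo (0 : ℝ) 1) {s : ℝ}, s ∈ Icc (0 : ℝ) 1 → |(t : ℝ) - s| ≤ 1 := by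
    intro t s hs
    have := t.2.1
    have := t.2.2
    rw [abs_le]
    constructor <;> linarith [hs.1, hs.2]
  have h1 : checkObjective p X θ ≤ approxObjective J p X θ + c / 2 * size X := by
    rw [← sumStat_const, approxObjective, ← sumStat_add]
    refine sumStat_le_sumStat fun t _ => ?_
    linarith [(abs_le.1 (Real.dist_eq _ _ ▸ hJ _ (hz t hθ.1))).1]
  have h2 : approxObjective J p X q ≤ checkObjective p X q + c / 2 * size X := by
    rw [← sumStat_const, checkObjective, ← sumStat_add]
    refine sumStat_le_sumStat fun t _ => ?_
    linarith [(abs_le.1 (Real.dist_eq _ _ ▸ hJ _ (hz t hq))).2]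
  linarith

end Sample

/-! ### The distribution function of a law with positive density -/

section Law

variable {P : Measure (Ioo (0 : ℝ) 1)}

theorem measureReal_Iic_continuous [IsProbabilityMeasure P] (hP : HasPositiveDensity P) :
    Continuous fun r : ℝ => P.real {t : Ioo (0 : ℝ) 1 | (t : ℝ) ≤ r} := by
  have hmeas : ∀ r : ℝ, MeasurableSet {t : Ioo (0 : ℝ) 1 | (t : ℝ) ≤ r} := fun r =>
    measurableSet_le measurable_subtype_coe measurable_const
  have e : (fun r : ℝ => P.real {t : Ioo (0 : ℝ) 1 | (t : ℝ) ≤ r}) =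
      fun r => ∫ t, {t : Ioo (0 : ℝ) 1 | (t : ℝ) ≤ r}.indicator 1 t ∂P := by
    funext r
    rw [integral_indicator_one (hmeas r)]
  rw [e, continuous_iff_continuousAt]
  intro r
  refine continuousAt_of_dominated (bound := fun _ => 1) (Eventually.of_forall fun s =>
    (measurable_one.indicator (hmeas s)).aestronglyMeasurable) (Eventually.of_forall fun s =>
    Eventually.of_forall fun t => ?_) (integrable_const _) ?_
  · by_cases h : (t : ℝ) ≤ s <;> simp [h]
  -- The integrand is locally constant in `r` for every `t ≠ r`, and `P` has no atoms.
  · have hatom : ∀ᵐ t : Ioo (0 : ℝ) 1 ∂P, (t : ℝ) ≠ r := by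
      refine Measure.ae_le_iff_absolutelyContinuous.2 hP.1 (ae_iff.2 ?_)
      rw [lebesgueUnit, comap_subtype_coe_apply measurableSet_Ioo]
      refine measure_mono_null ?_ (Real.volume_singleton (a := r))
      rintro _ ⟨t, ht, rfl⟩
      exact not_not.1 ht
    filter_upwards [hatom] with t ht
    rcases lt_or_gt_of_ne ht with h | h
    · refine (continuousAt_const (y := (1 : ℝ))).congr ?_
      filter_upwards [Ioi_mem_nhds h] with s hs
      simp [(mem_Ioi.1 hs).le]
    · refine (continuousAt_const (y := (0 : ℝ))).congr ?_
      filter_upwards [Iio_mem_nhds h] with s hs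
      simp [mem_Iio.1 hs]

/-- Positivity of the density makes Lebesgue measure on `(0, 1)` absolutely continuous with respect to
`P`, so that `P` charges every interval that meets `(0, 1)`. -/
theorem measure_Ioc_pos (hP : HasPositiveDensity P) {a b : ℝ} (hab : a < b) (hb : 0 < b)
    (ha : a < 1) : 0 < P {t : Ioo (0 : ℝ) 1 | a < t ∧ (t : ℝ) ≤ b} := by
  have hac : lebesgueUnit ≪ P :=
    (withDensity_absolutelyContinuous' (Measure.measurable_rnDeriv _ _).aemeasurable
      (hP.2.mono fun t ht => ht.ne')).trans
      (Measure.absolutelyContinuous_of_le (Measure.withDensity_rnDeriv_le _ _))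
  refine pos_iff_ne_zero.2 fun h0 => ?_
  have h1 := hac h0
  rw [lebesgueUnit, comap_subtype_coe_apply measurableSet_Ioo] at h1
  have hlt : max a 0 < min b 1 := max_lt (lt_min hab ha) (lt_min hb one_pos)
  have h2 : volume (Ioo (max a 0) (min b 1)) = 0 := by
    refine measure_mono_null ?_ h1
    rintro t ⟨ht1, ht2⟩
    rw [max_lt_iff] at ht1
    rw [lt_min_iff] at ht2
    exact ⟨⟨t, ht1.2, ht2.2⟩, ⟨ht1.1, ht2.1.le⟩, rfl⟩
  rw [Real.volume_Ioo, ENNReal.ofReal_eq_zero] at h2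
  linarith

theorem measureReal_Iic_lt [IsProbabilityMeasure P] (hP : HasPositiveDensity P) {a b : ℝ}
    (hab : a < b) (hb : 0 < b) (ha : a < 1) : P.real {t : Ioo (0 : ℝ) 1 | (t : ℝ) ≤ a} <
      P.real {t : Ioo (0 : ℝ) 1 | (t : ℝ) ≤ b} := by
  have hu : {t : Ioo (0 : ℝ) 1 | (t : ℝ) ≤ b} =
      {t : Ioo (0 : ℝ) 1 | (t : ℝ) ≤ a} ∪ {t : Ioo (0 : ℝ) 1 | a < t ∧ (t : ℝ) ≤ b} := by
    ext t
    simp only [mem_ofPred_eq, mem_union]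
    constructor
    · intro h
      exact (le_or_gt (t : ℝ) a).imp id fun h' => ⟨h', h⟩
    · rintro (h | h)
      · exact h.trans hab.le
      · exact h.2
  have hd : Disjoint {t : Ioo (0 : ℝ) 1 | (t : ℝ) ≤ a}
      {t : Ioo (0 : ℝ) 1 | a < t ∧ (t : ℝ) ≤ b} :=
    Set.disjoint_left.2 fun t h h' => not_lt.2 h h'.1
  have hm : MeasurableSet {t : Ioo (0 : ℝ) 1 | a < t ∧ (t : ℝ) ≤ b} :=
    measurable_subtype_coe measurableSet_Ioc
  rw [hu, measureReal_union hd hm]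
  have := ENNReal.toReal_pos (measure_Ioc_pos hP hab hb ha).ne' (measure_ne_top _ _)
  exact lt_add_of_pos_right _ this

theorem exists_quantile [IsProbabilityMeasure P] (hP : HasPositiveDensity P) {p : ℝ}
    (hp : p ∈ Ioo (0 : ℝ) 1) :
    ∃ q ∈ Ioo (0 : ℝ) 1, P.real {t : Ioo (0 : ℝ) 1 | (t : ℝ) ≤ q} = p := by
  have h0 : P.real {t : Ioo (0 : ℝ) 1 | (t : ℝ) ≤ 0} = 0 := by
    have : {t : Ioo (0 : ℝ) 1 | (t : ℝ) ≤ 0} = ∅ :=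
      eq_empty_of_forall_notMem fun t ht => not_lt.2 ht t.2.1
    rw [this, measureReal_empty]
  have h1 : P.real {t : Ioo (0 : ℝ) 1 | (t : ℝ) ≤ 1} = 1 := by
    have : {t : Ioo (0 : ℝ) 1 | (t : ℝ) ≤ 1} = univ := eq_univ_of_forall fun t => t.2.2.le
    rw [this, probReal_univ]
  have := intermediate_value_Ioo (zero_le_one' ℝ) (measureReal_Iic_continuous hP).continuousOn
  simp only [h0, h1] at this
  exact this hp

end Law

/-! ### Almost sure convergence of the empirical distribution function -/

theorem ae_tendsto_empCDF {Ω : Type*} [MeasurableSpace Ω] {μ : Measure Ω} [IsProbabilityMeasure μ]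
    {P : Measure (Ioo (0 : ℝ) 1)} {x : ℕ → Ω → Ioo (0 : ℝ) 1} (hmeas : ∀ i, Measurable (x i))
    (hindep : iIndepFun x μ) (hlaw : ∀ i, μ.map (x i) = P) (r : ℝ) :
    ∀ᵐ ω ∂μ, Tendsto (fun n => empCDF (firstObs (fun i => x i ω) n) r) atTop
      (𝓝 (P.real {t | (t : ℝ) ≤ r})) := by
  classical
  have hS : MeasurableSet {t : Ioo (0 : ℝ) 1 | (t : ℝ) ≤ r} :=
    measurableSet_le measurable_subtype_coe measurable_const
  set φ : Ioo (0 : ℝ) 1 → ℝ := fun t => if (t : ℝ) ≤ r then 1 else 0 with hφ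
  have hφm : Measurable φ := Measurable.ite hS measurable_const measurable_const
  have hφb : ∀ t, ‖φ t‖ ≤ 1 := fun t => by simp only [hφ]; split_ifs <;> simp
  have hmean : ∫ ω, φ (x 0 ω) ∂μ = P.real {t | (t : ℝ) ≤ r} := by
    rw [← hlaw 0, ← integral_map (hmeas 0).aemeasurable hφm.aestronglyMeasurable,
      ← integral_indicator_one hS]
    rfl
  have hlln := strong_law_ae_real (μ := μ) (fun i ω => φ (x i ω))
    (Integrable.of_bound (hφm.comp (hmeas 0)).aestronglyMeasurable 1
      (Eventually.of_forall fun ω => hφb _))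
    (fun i j hij => (hindep.indepFun hij).comp hφm hφm)
    (fun i => IdentDistrib.comp
      ⟨(hmeas i).aemeasurable, (hmeas 0).aemeasurable, (hlaw i).trans (hlaw 0).symm⟩ hφm)
  filter_upwards [hlln] with ω hω
  rw [hmean] at hω
  refine (hω.comp (tendsto_add_atTop_nat 1)).congr fun n => ?_
  rw [empCDF, size_firstObs, sumStat_firstObs, Function.comp, Nat.cast_succ]

/-! ### Separation of near-minimizers from the quantile -/

section Separation

variable {P : Measure (Ioo (0 : ℝ) 1)} [IsProbabilityMeasure P] {p q : ℝ}
  {y : ℕ → Ioo (0 : ℝ) 1}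

/-- If the empirical distribution functions converge at `q` and at a second point `r`, the mean
excess of the check-loss objective over its value at `q` is eventually bounded away from zero beyond
any `θ₀` strictly beyond `r`; the ratio in the conclusion expresses, for both directions at once,
that `θ` is at least as far from `r` as `θ₀` on the same side. The subgradient at `q` gives a lower
bound tending to zero at `r`, and the subgradient at `r` gives a strictly positive slope from `r`
on. -/
theorem exists_eventually_lt_of_beyond {θ₀ r Fr : ℝ}
    (hq : Tendsto (fun n => empCDF (firstObs y n) q) atTop (𝓝 p))
    (hr : Tendsto (fun n => empCDF (firstObs y n) r) atTop (𝓝 Fr))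
    (hsep : 0 < (θ₀ - r) * (Fr - p)) :
    ∃ c > 0, ∀ᶠ n in atTop, ∀ θ, 1 ≤ (θ - r) / (θ₀ - r) →
      size (firstObs y n) * c <
        checkObjective p (firstObs y n) θ - checkObjective p (firstObs y n) q := by
  have hne : θ₀ - r ≠ 0 := left_ne_zero_of_mul hsep.ne'
  set A := (θ₀ - r) * (Fr - p) with hA
  have h1 : Tendsto (fun n => (r - q) * (empCDF (firstObs y n) q - p)) atTop (𝓝 0) := by
    simpa using (hq.sub_const p).const_mul (r - q)
  have h2 : Tendsto (fun n => (θ₀ - r) * (empCDF (firstObs y n) r - p)) atTop (𝓝 A) :=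
    (hr.sub_const p).const_mul _
  -- The slope term exceeds `A / 2` and the term at `q` exceeds `-A / 4`, which leaves `A / 4`.
  refine ⟨A / 4, by positivity, ?_⟩
  filter_upwards [h1.eventually_const_lt (by linarith : -(A / 4) < 0),
    h2.eventually_const_lt (by linarith : A / 2 < A)] with n hn1 hn2 θ hθ
  have hs := size_pos (firstObs y n)
  have g1 := checkObjective_sub_ge p (firstObs y n) q r
  have g2 := checkObjective_sub_ge p (firstObs y n) r θ
  have e : (θ - r) * (empCDF (firstObs y n) r - p) =
      (θ - r) / (θ₀ - r) * ((θ₀ - r) * (empCDF (firstObs y n) r - p)) := by field_simp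
  have g3 : A / 2 < (θ - r) * (empCDF (firstObs y n) r - p) := by
    rw [e]
    exact hn2.trans_le (le_mul_of_one_le_left (by linarith) hθ)
  have g4 := mul_lt_mul_of_pos_left hn1 hs
  have g5 := mul_lt_mul_of_pos_left g3 hs
  linarith

/-- Outside any neighbourhood of `q`, the mean check loss eventually exceeds its value at `q` by a
fixed positive amount, uniformly in `θ`. -/
theorem exists_eventually_lt_of_le_abs_sub (hP : HasPositiveDensity P) (hq : q ∈ Ioo (0 : ℝ) 1)
    (hqp : P.real {t | (t : ℝ) ≤ q} = p)
    (hy : Tendsto (fun n => empCDF (firstObs y n) q) atTop (𝓝 p))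
    (hrat : ∀ r : ℚ, Tendsto (fun n => empCDF (firstObs y n) r) atTop
      (𝓝 (P.real {t | (t : ℝ) ≤ r}))) {ε : ℝ} (hε : 0 < ε) :
    ∃ c > 0, ∀ᶠ n in atTop, ∀ θ, ε ≤ |θ - q| →
      size (firstObs y n) * c <
        checkObjective p (firstObs y n) θ - checkObjective p (firstObs y n) q := by
  obtain ⟨r, hr1, hr2⟩ := exists_rat_btwn (by linarith : q < q + ε)
  obtain ⟨s, hs1, hs2⟩ := exists_rat_btwn (by linarith : q - ε < q)
  have hFr := measureReal_Iic_lt hP hr1 (hq.1.trans hr1) hq.2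
  have hFs := measureReal_Iic_lt hP hs2 hq.1 (hs2.trans hq.2)
  rw [hqp] at hFr hFs
  obtain ⟨c, hc, h⟩ := exists_eventually_lt_of_beyond (θ₀ := q + ε) hy (hrat r)
    (mul_pos (by linarith) (by linarith))
  obtain ⟨d, hd, h'⟩ := exists_eventually_lt_of_beyond (θ₀ := q - ε) hy (hrat s)
    (mul_pos_of_neg_of_neg (by linarith) (by linarith))
  refine ⟨min c d, lt_min hc hd, ?_⟩
  filter_upwards [h, h'] with n hn hn' θ hθ
  have hsz := size_pos (firstObs y n)
  rcases le_abs.1 hθ with h1 | h1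
  · refine lt_of_le_of_lt ?_ (hn θ ((one_le_div (by linarith)).2 (by linarith)))
    gcongr
    exact min_le_left _ _
  · refine lt_of_le_of_lt ?_ (hn' θ ((one_le_div_of_neg (by linarith)).2 (by linarith)))
    gcongr
    exact min_le_right _ _

theorem eventually_sampleQuantiles_subset (hp : p ∈ Ioo (0 : ℝ) 1) (hP : HasPositiveDensity P)
    (hq : q ∈ Ioo (0 : ℝ) 1) (hqp : P.real {t | (t : ℝ) ≤ q} = p)
    (hy : Tendsto (fun n => empCDF (firstObs y n) q) atTop (𝓝 p))
    (hrat : ∀ r : ℚ, Tendsto (fun n => empCDF (firstObs y n) r) atTop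
      (𝓝 (P.real {t | (t : ℝ) ≤ r}))) {ε : ℝ} (hε : 0 < ε) :
    ∀ᶠ n in atTop, sampleQuantiles p (firstObs y n) ⊆ Metric.ball q ε := by
  obtain ⟨c, hc, h⟩ := exists_eventually_lt_of_le_abs_sub hP hq hqp hy hrat hε
  filter_upwards [h] with n hn θ hθ
  rw [sampleQuantiles_eq_checkMinimizers hp] at hθ
  rw [Metric.mem_ball, Real.dist_eq]
  by_contra! hfar
  have h1 := hn θ hfar
  have h2 := isMinOn_iff.1 hθ.2 q (Ioo_subset_Icc_self hq)
  have h3 := mul_pos (size_pos (firstObs y n)) hc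
  linarith

/-- For `J` large the approximate quantiles eventually lie close to `q`: they minimize the mean
check loss up to an error that is uniformly small in `n`. -/
theorem eventually_approxQuantiles_subset (hP : HasPositiveDensity P)
    (hq : q ∈ Ioo (0 : ℝ) 1) (hqp : P.real {t | (t : ℝ) ≤ q} = p)
    (hy : Tendsto (fun n => empCDF (firstObs y n) q) atTop (𝓝 p))
    (hrat : ∀ r : ℚ, Tendsto (fun n => empCDF (firstObs y n) r) atTop
      (𝓝 (P.real {t | (t : ℝ) ≤ r}))) {ε : ℝ} (hε : 0 < ε) :
    ∀ᶠ J in atTop, ∀ᶠ n in atTop,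
      approxQuantiles J p (firstObs y n) ⊆ Metric.ball q ε := by
  obtain ⟨c, hc, h⟩ := exists_eventually_lt_of_le_abs_sub hP hq hqp hy hrat hε
  filter_upwards [eventually_abs_fourierAbs_sub_abs_le hc] with J hJ
  filter_upwards [h] with n hn θ hθ
  rw [Metric.mem_ball, Real.dist_eq]
  by_contra! hfar
  exact (hn θ hfar).not_ge
    (checkObjective_sub_le_of_mem_approxQuantiles hJ (Ioo_subset_Icc_self hq) hθ)

end Separation

theorem limsup_liminf_mem_closedBall {u : ℕ → ℝ} {q ε : ℝ}
    (h : ∀ᶠ n in atTop, u n ∈ Metric.ball q ε) :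
    limsup u atTop ∈ Metric.closedBall q ε ∧ liminf u atTop ∈ Metric.closedBall q ε := by
  have hl : ∀ᶠ n in atTop, q - ε ≤ u n := h.mono fun n hn => by
    rw [Real.ball_eq_Ioo] at hn; exact hn.1.le
  have hr : ∀ᶠ n in atTop, u n ≤ q + ε := h.mono fun n hn => by
    rw [Real.ball_eq_Ioo] at hn; exact hn.2.le
  have hbl : IsBoundedUnder (· ≥ ·) atTop u := isBoundedUnder_of_eventually_ge hl
  have hbr : IsBoundedUnder (· ≤ ·) atTop u := isBoundedUnder_of_eventually_le hr
  rw [Real.closedBall_eq_Icc]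
  have h1 : q - ε ≤ liminf u atTop := le_liminf_of_le hbr.isCoboundedUnder_ge hl
  have h2 : limsup u atTop ≤ q + ε := limsup_le_of_le hbl.isCoboundedUnder_le hr
  have h3 := liminf_le_limsup hbr hbl
  exact ⟨⟨h1.trans h3, h2⟩, h1, h3.trans h2⟩

/-! ### Consistency of the sample quantiles and of their approximants -/

theorem mainTheorem1 {Ω : Type*} [MeasurableSpace Ω] (μ : Measure Ω) [IsProbabilityMeasure μ]
    (P : Measure (Ioo (0 : ℝ) 1)) [IsProbabilityMeasure P]
    (x : ℕ → Ω → Ioo (0 : ℝ) 1) (hmeas : ∀ i, Measurable (x i))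
    (hindep : iIndepFun x μ) (hlaw : ∀ i, μ.map (x i) = P)
    (hP : HasPositiveDensity P) (p : ℝ) (hp : p ∈ Ioo (0 : ℝ) 1) :
    -- sample quantiles: M-estimator, uniqueness, and the limits
    (∃ q : ℝ, q ∈ Ioo (0 : ℝ) 1 ∧ P.real {t | (t : ℝ) ≤ q} = p ∧
      (∀ᵐ ω ∂μ,
        (∀ n : ℕ,
          (sampleQuantiles p (firstObs (fun i => x i ω) n)).Nonempty ∧
          sampleQuantiles p (firstObs (fun i => x i ω) n) =
            checkMinimizers p (firstObs (fun i => x i ω) n) ∧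
          ((¬ ∃ k : ℕ, ((n : ℝ) + 1) * p = k) →
            ∃! θ, θ ∈ sampleQuantiles p (firstObs (fun i => x i ω) n))) ∧
        Tendsto (fun n => Metric.diam (sampleQuantiles p (firstObs (fun i => x i ω) n)))
          atTop (𝓝 0) ∧
        ∀ qhat : ℕ → ℝ, (∀ n, qhat n ∈ sampleQuantiles p (firstObs (fun i => x i ω) n)) →
          Tendsto qhat atTop (𝓝 q)) ∧
      (ZetaTendstoDensity P →
        ∀ᵐ ω ∂μ, ∀ qhat : ℕ → ℕ → ℝ,
          (∀ J n, qhat J n ∈ approxQuantiles J p (firstObs (fun i => x i ω) n)) →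
          Tendsto (fun J => limsup (fun n => qhat J n) atTop) atTop (𝓝 q) ∧
          Tendsto (fun J => liminf (fun n => qhat J n) atTop) atTop (𝓝 q))) ∧
    -- the approximants are weakly embarrassingly parallel statistics
    (∀ J : ℕ,
      IsFAS (fun t θ : ℝ => (fourierAbs J (t - θ) : ℂ)) ∧
      (∀ X : Sample (Ioo (0 : ℝ) 1), (approxQuantiles J p X).Nonempty) ∧
      IsWEP (approxQuantiles J p) ∧
      (∀ choose : Set ℝ → ℝ, (∀ S : Set ℝ, S.Nonempty → choose S ∈ S) →
        IsWEP (fun X => choose (approxQuantiles J p X))) ∧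
      IsSEP (fun (X : Sample (Ioo (0 : ℝ) 1)) (_ : Fin 1) => size X) ∧
      (∀ j : Fin J, IsSEP (fun X (_ : Fin 1) => cosStat j X)) ∧
      (∀ j : Fin J, IsSEP (fun X (_ : Fin 1) => sinStat j X)) ∧
      ∃ G : ℝ → (Fin J → ℝ) → (Fin J → ℝ) → Set ℝ, ∀ X : Sample (Ioo (0 : ℝ) 1),
        approxQuantiles J p X =
          G (size X) (fun j => cosStat j X) (fun j => sinStat j X)) := by
  obtain ⟨q, hq, hqp⟩ := exists_quantile hP hp
  have hae : ∀ᵐ ω ∂μ, Tendsto (fun n => empCDF (firstObs (fun i => x i ω) n) q) atTop (𝓝 p) ∧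
      ∀ r : ℚ, Tendsto (fun n => empCDF (firstObs (fun i => x i ω) n) r) atTop
        (𝓝 (P.real {t | (t : ℝ) ≤ r})) := by
    have h := ae_tendsto_empCDF hmeas hindep hlaw q
    rw [hqp] at h
    exact h.and (ae_all_iff.2 fun r => ae_tendsto_empCDF hmeas hindep hlaw r)
  refine ⟨⟨q, hq, hqp, ?_, fun _ => ?_⟩, fun J => ⟨isFAS_fourierAbs J, approxQuantiles_nonempty J p,
    isWEP_comp_approxQuantiles J p id, fun choose _ => isWEP_comp_approxQuantiles J p choose,
    isSEP_size, fun j => isSEP_sumStat _, fun j => isSEP_sumStat _,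
    fun n c s => argminUnit (trigObjective J p n c s), approxQuantiles_eq J p⟩⟩
  · filter_upwards [hae] with ω hω
    refine ⟨fun n => ⟨sampleQuantiles_nonempty hp _, sampleQuantiles_eq_checkMinimizers hp _,
      fun hn => existsUnique_sampleQuantiles hp (by rwa [size_firstObs])⟩, ?_, fun qhat hqhat => ?_⟩
    · refine Metric.tendsto_nhds.2 fun ε hε => ?_
      filter_upwards [eventually_sampleQuantiles_subset hp hP hq hqp hω.1 hω.2
        (by positivity : 0 < ε / 4)] with n hn
      rw [Real.dist_0_eq_abs, abs_of_nonneg Metric.diam_nonneg]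
      have h1 := Metric.diam_mono hn Metric.isBounded_ball
      have h2 := Metric.diam_ball (x := q) (by positivity : 0 ≤ ε / 4)
      linarith
    · refine Metric.tendsto_nhds.2 fun ε hε => ?_
      filter_upwards [eventually_sampleQuantiles_subset hp hP hq hqp hω.1 hω.2 hε] with n hn
      exact hn (hqhat n)
  · filter_upwards [hae] with ω hω qhat hqhat
    have key : ∀ ε > 0, ∀ᶠ J in atTop,
        limsup (fun n => qhat J n) atTop ∈ Metric.closedBall q (ε / 2) ∧
        liminf (fun n => qhat J n) atTop ∈ Metric.closedBall q (ε / 2) := fun ε hε => by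
      filter_upwards [eventually_approxQuantiles_subset hP hq hqp hω.1 hω.2
        (half_pos hε)] with J hJ
      exact limsup_liminf_mem_closedBall (hJ.mono fun n hn => hn (hqhat J n))
    constructor
    · refine Metric.tendsto_nhds.2 fun ε hε => ?_
      filter_upwards [key ε hε] with J hJ using hJ.1.trans_lt (half_lt_self hε)
    · refine Metric.tendsto_nhds.2 fun ε hε => ?_
      filter_upwards [key ε hε] with J hJ using hJ.2.trans_lt (half_lt_self hε)
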